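/- Let $n\ge 1$ and let $\|\cdot\|$ be the Euclidean norm on $\mathbb{R}^n$. For $f:\mathbb{R}^n\to\mathbb{R}$, a sequence $(x_k)_{k\ge 0}$ in $\mathbb{R}^n$ is called a BFGS sequence for $f$ if $f$ is differentiable at each $x_k$ with $\nabla f(x_k)\neq 0$, and there exist parameters $0<\mu<\nu<1$ and a (symmetric) positive definite $n\times n$ matrix $H_0$ such that the vectors $$s_k=x_{k+1}-x_k,\qquad y_k=\nabla f(x_{k+1})-\nabla f(x_k)$$ and the matrices defined recursively by $$V_k=I-\frac{s_ky_k^T}{s_k^Ty_k},\qquad H_{k+1}=V_kH_kV_k^T+\frac{s_ks_k^T}{s_k^Ty_k}$$ satisfy, for all $k=0,1,2,\dots$, $$H_k\nabla f(x_k)\in-\mathbb{R}_+s_k,\qquad f(x_{k+1})\le f(x_k)+\mu\nabla f(x_k)^Ts_k,\qquad \nabla f(x_{k+1})^Ts_k\ge\nu\nabla f(x_k)^Ts_k .$$ (These conditions imply $s_k^Ty_k>0$ for all $k$, so the recursion is well defined.) Then every BFGS sequence $(x_k)$ for the function $f=\|\cdot\|$ on $\mathbb{R}^n$ converges to $0$.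 -/

import Mathlib

open scoped Matrix

namespace BFGS

/-- The matrix `V = I - s yᵀ / (sᵀ y)`. -/
noncomputable def updateFactor {n : ℕ} (s y : EuclideanSpace ℝ (Fin n)) :
    Matrix (Fin n) (Fin n) ℝ :=
  1 - (s.ofLp ⬝ᵥ y.ofLp)⁻¹ • Matrix.vecMulVec s.ofLp y.ofLp

/-- The BFGS update of an approximate inverse Hessian:
`H₊ = V H Vᵀ + s sᵀ / (sᵀ y)`. -/
noncomputable def update {n : ℕ} (s y : EuclideanSpace ℝ (Fin n))
    (H : Matrix (Fin n) (Fin n) ℝ) : Matrix (Fin n) (Fin n) ℝ :=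
  updateFactor s y * H * (updateFactor s y)ᵀ
    + (s.ofLp ⬝ᵥ y.ofLp)⁻¹ • Matrix.vecMulVec s.ofLp s.ofLp

/-- The step `s_k = x_{k+1} - x_k`. -/
def step {n : ℕ} (x : ℕ → EuclideanSpace ℝ (Fin n)) (k : ℕ) : EuclideanSpace ℝ (Fin n) :=
  x (k + 1) - x k

/-- The gradient difference `y_k = ∇f(x_{k+1}) - ∇f(x_k)`. -/
noncomputable def gradDiff {n : ℕ} (f : EuclideanSpace ℝ (Fin n) → ℝ)
    (x : ℕ → EuclideanSpace ℝ (Fin n)) (k : ℕ) : EuclideanSpace ℝ (Fin n) :=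
  gradient f (x (k + 1)) - gradient f (x k)

/-- The approximate inverse Hessians `H_k`, generated from `H₀` by the BFGS update. -/
noncomputable def invHessian {n : ℕ} (f : EuclideanSpace ℝ (Fin n) → ℝ)
    (x : ℕ → EuclideanSpace ℝ (Fin n)) (H₀ : Matrix (Fin n) (Fin n) ℝ) :
    ℕ → Matrix (Fin n) (Fin n) ℝ
  | 0 => H₀
  | k + 1 => update (step x k) (gradDiff f x k) (invHessian f x H₀ k)

/-- `x` is a BFGS sequence for `f : ℝⁿ → ℝ`: `f` is differentiable with nonzero gradient at each
iterate, and for some `0 < μ < ν < 1` and some positive definite `H₀`, every step is in the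
quasi-Newton direction, `H_k ∇f(x_k) ∈ -ℝ₊ s_k`, and satisfies the Armijo and weak Wolfe
conditions.  (No separate requirement `s_kᵀ y_k ≠ 0` is needed in order that the divisions in the
update make sense: the conditions below force `s_kᵀ y_k > 0`.) -/
def IsBFGSSequence {n : ℕ} (f : EuclideanSpace ℝ (Fin n) → ℝ)
    (x : ℕ → EuclideanSpace ℝ (Fin n)) : Prop :=
  (∀ k, DifferentiableAt ℝ f (x k) ∧ gradient f (x k) ≠ 0) ∧
  ∃ (μ ν : ℝ) (H₀ : Matrix (Fin n) (Fin n) ℝ), 0 < μ ∧ μ < ν ∧ ν < 1 ∧ H₀.PosDef ∧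
    ∀ k,
      (∃ t : ℝ, 0 ≤ t ∧
        invHessian f x H₀ k *ᵥ (gradient f (x k)).ofLp = -(t • (step x k).ofLp)) ∧
      f (x (k + 1)) ≤ f (x k) + μ * inner ℝ (gradient f (x k)) (step x k) ∧
      ν * inner ℝ (gradient f (x k)) (step x k) ≤ inner ℝ (gradient f (x (k + 1))) (step x k)

end BFGS

/-!
Write `B = H⁻¹`. The Byrd–Nocedal potential `tr B - log det B` is bounded below on positive definite
matrices. Along a BFGS step with gradient `g` it grows by at most
`‖y‖² / sᵀy - 1 + log (-gᵀs / ((1 - ν) ‖g‖²))`. If `f` is bounded below along the sequence, the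
Armijo condition forces `gᵀs → 0`, so the logarithm tends to `-∞` as long as `‖g‖` stays away from
zero. If moreover `‖y‖² / sᵀy` is bounded, the potential tends to `-∞`, a contradiction. Hence
gradients become arbitrarily small (Powell's argument).

The gradients of the Euclidean norm are unit vectors, and if `‖x_k‖` decreases to some `r > 0` then
`‖y‖² / sᵀy ≤ 1 / r`; so the limit must be `r = 0`.
-/

namespace BFGS

open Filter Matrix Topology

section DualUpdate

variable {ι K : Type*} [Fintype ι]

theorem det_one_add_vecMulVec_add_vecMulVec [DecidableEq ι] [CommRing K] (u v w z : ι → K) :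
    (1 + (vecMulVec u v + vecMulVec w z)).det =
      (1 + v ⬝ᵥ u) * (1 + z ⬝ᵥ w) - (v ⬝ᵥ w) * (z ⬝ᵥ u) := by
  have hfactor : vecMulVec u v + vecMulVec w z = (of ![u, w])ᵀ * of ![v, z] := by
    ext i j
    simp [mul_apply, vecMulVec_apply]
  rw [hfactor, det_one_add_mul_comm, det_fin_two]
  simp [vecMul, dotProduct]

variable [Field K]

/-- The BFGS update `B₊ = B - B s (B s)ᵀ / (sᵀ B s) + y yᵀ / (sᵀ y)` of a symmetric approximate
Hessian `B`. It is the inverse of `update` applied to `H = B⁻¹`. -/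
def dualUpdate (s y : ι → K) (B : Matrix ι ι K) : Matrix ι ι K :=
  B - (s ⬝ᵥ B *ᵥ s)⁻¹ • vecMulVec (B *ᵥ s) (B *ᵥ s) + (s ⬝ᵥ y)⁻¹ • vecMulVec y y

theorem dualUpdate_mulVec_self {s y : ι → K} {B : Matrix ι ι K}
    (hsy : s ⬝ᵥ y ≠ 0) (hsB : s ⬝ᵥ B *ᵥ s ≠ 0) : dualUpdate s y B *ᵥ s = y := by
  simp only [dualUpdate, add_mulVec, sub_mulVec, smul_mulVec, vecMulVec_mulVec, op_smul_eq_smul,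
    dotProduct_comm y s, dotProduct_comm (B *ᵥ s) s, smul_smul, inv_mul_cancel₀ hsy,
    inv_mul_cancel₀ hsB, one_smul, sub_self, zero_add]

theorem trace_dualUpdate (s y : ι → K) (B : Matrix ι ι K) :
    (dualUpdate s y B).trace =
      B.trace - (B *ᵥ s ⬝ᵥ B *ᵥ s) / (s ⬝ᵥ B *ᵥ s) + (y ⬝ᵥ y) / (s ⬝ᵥ y) := by
  simp only [dualUpdate, trace_add, trace_sub, trace_smul, trace_vecMulVec, smul_eq_mul,
    div_eq_inv_mul]

theorem det_dualUpdate [DecidableEq ι] {s y : ι → K} {B : Matrix ι ι K} (hB : B.IsSymm)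
    (hdet : B.det ≠ 0) (hsy : s ⬝ᵥ y ≠ 0) (hsB : s ⬝ᵥ B *ᵥ s ≠ 0) :
    (dualUpdate s y B).det = B.det * ((s ⬝ᵥ y) / (s ⬝ᵥ B *ᵥ s)) := by
  have hBB : B * B⁻¹ = 1 := mul_nonsing_inv B hdet.isUnit
  have hfactor : dualUpdate s y B = B * (1 + (vecMulVec s (-(s ⬝ᵥ B *ᵥ s)⁻¹ • B *ᵥ s) +
      vecMulVec (B⁻¹ *ᵥ y) ((s ⬝ᵥ y)⁻¹ • y))) := by
    simp only [vecMulVec_smul, mul_add, mul_one, Matrix.mul_smul, mul_vecMulVec, mulVec_mulVec,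
      hBB, one_mulVec, neg_smul, vecMulVec_neg, mul_neg, dualUpdate, sub_eq_add_neg, add_assoc]
  have hBs : (B *ᵥ s) ⬝ᵥ (B⁻¹ *ᵥ y) = s ⬝ᵥ y := by
    rw [← vecMul_transpose, hB.eq, ← dotProduct_mulVec, mulVec_mulVec, hBB, one_mulVec]
  rw [hfactor, det_mul, det_one_add_vecMulVec_add_vecMulVec]
  simp only [smul_dotProduct, hBs, dotProduct_comm y s, dotProduct_comm (B *ᵥ s) s, smul_eq_mul]
  field_simp
  ring

end DualUpdate

section Inverse

variable {n : ℕ} {s y : EuclideanSpace ℝ (Fin n)}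

theorem dualUpdate_mul_updateFactor {B : Matrix (Fin n) (Fin n) ℝ}
    (hsy : s.ofLp ⬝ᵥ y.ofLp ≠ 0) (hsB : s.ofLp ⬝ᵥ B *ᵥ s.ofLp ≠ 0) :
    dualUpdate s.ofLp y.ofLp B * updateFactor s y =
      B - (s.ofLp ⬝ᵥ B *ᵥ s.ofLp)⁻¹ • vecMulVec (B *ᵥ s.ofLp) (B *ᵥ s.ofLp) := by
  rw [updateFactor, mul_sub, mul_one, Matrix.mul_smul, mul_vecMulVec,
    dualUpdate_mulVec_self hsy hsB, dualUpdate, add_sub_cancel_right]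

theorem dualUpdate_mul_update {B H : Matrix (Fin n) (Fin n) ℝ} (hB : B.IsSymm) (hBH : B * H = 1)
    (hsy : s.ofLp ⬝ᵥ y.ofLp ≠ 0) (hsB : s.ofLp ⬝ᵥ B *ᵥ s.ofLp ≠ 0) :
    dualUpdate s.ofLp y.ofLp B * update s y H = 1 := by
  have hBsH : (B *ᵥ s.ofLp) ᵥ* H = s.ofLp := by
    rw [← vecMul_transpose, hB.eq, vecMul_vecMul, hBH, vecMul_one]
  have hleft : dualUpdate s.ofLp y.ofLp B * updateFactor s y * H =
      1 - (s.ofLp ⬝ᵥ B *ᵥ s.ofLp)⁻¹ • vecMulVec (B *ᵥ s.ofLp) s.ofLp := by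
    rw [dualUpdate_mul_updateFactor hsy hsB, sub_mul, hBH, smul_mul_assoc, vecMulVec_mul, hBsH]
  have hsV : s.ofLp ᵥ* (updateFactor s y)ᵀ = 0 := by
    simp only [updateFactor, vecMul_transpose, sub_mulVec, one_mulVec, smul_mulVec,
      vecMulVec_mulVec, op_smul_eq_smul, dotProduct_comm y.ofLp, smul_smul, inv_mul_cancel₀ hsy,
      one_smul, sub_self]
  have hV : (updateFactor s y)ᵀ = 1 - (s.ofLp ⬝ᵥ y.ofLp)⁻¹ • vecMulVec y.ofLp s.ofLp := by
    rw [updateFactor, transpose_sub, transpose_one, transpose_smul, transpose_vecMulVec]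
  rw [update, mul_add, ← mul_assoc, ← mul_assoc, hleft, sub_mul, one_mul, smul_mul_assoc,
    vecMulVec_mul, hsV, vecMulVec_zero, smul_zero, sub_zero, Matrix.mul_smul, mul_vecMulVec,
    dualUpdate_mulVec_self hsy hsB, hV, sub_add_cancel]

variable {H : Matrix (Fin n) (Fin n) ℝ}

theorem dualUpdate_inv_mul_update (hH : H.PosDef) (hsy : 0 < s.ofLp ⬝ᵥ y.ofLp) :
    dualUpdate s.ofLp y.ofLp H⁻¹ * update s y H = 1 := by
  have hs : s.ofLp ≠ 0 := by
    rintro h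
    simp [h] at hsy
  have hsHs : 0 < s.ofLp ⬝ᵥ H⁻¹ *ᵥ s.ofLp := by simpa using hH.inv.dotProduct_mulVec_pos hs
  exact dualUpdate_mul_update hH.inv.isHermitian
    (nonsing_inv_mul H hH.det_pos.ne'.isUnit) hsy.ne' hsHs.ne'

theorem inv_update (hH : H.PosDef) (hsy : 0 < s.ofLp ⬝ᵥ y.ofLp) :
    (update s y H)⁻¹ = dualUpdate s.ofLp y.ofLp H⁻¹ :=
  inv_eq_left_inv (dualUpdate_inv_mul_update hH hsy)

theorem posDef_update (hH : H.PosDef) (hsy : 0 < s.ofLp ⬝ᵥ y.ofLp) : (update s y H).PosDef := by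
  have hpsd : (update s y H).PosSemidef := by
    refine .add ?_ (.smul ?_ (inv_nonneg.2 hsy.le))
    · simpa using hH.posSemidef.mul_mul_conjTranspose_same (updateFactor s y)
    · simpa using posSemidef_vecMulVec_self_star s.ofLp
  exact hpsd.posDef_iff_isUnit.2
    (.of_mul_eq_one _ (mul_eq_one_comm.1 (dualUpdate_inv_mul_update hH hsy)))

end Inverse

section Potential

variable {ι : Type*} [Fintype ι] [DecidableEq ι] {B : Matrix ι ι ℝ}

/-- The Byrd–Nocedal potential `tr B - log det B` of an approximate Hessian `B`, meaningful for
positive definite `B`. -/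
noncomputable def potential (B : Matrix ι ι ℝ) : ℝ :=
  B.trace - Real.log B.det

theorem card_le_potential (hB : B.PosDef) : Fintype.card ι ≤ potential B := by
  rw [potential, hB.isHermitian.trace_eq_sum_eigenvalues, hB.isHermitian.det_eq_prod_eigenvalues]
  simp only [RCLike.ofReal_real_eq_id, id_eq]
  rw [Real.log_prod fun i _ => (hB.eigenvalues_pos i).ne', ← Finset.sum_sub_distrib,
    Fintype.card_eq_sum_ones, Nat.cast_sum, Nat.cast_one]
  refine Finset.sum_le_sum fun i _ => ?_
  linarith [Real.log_le_sub_one_of_pos (hB.eigenvalues_pos i)]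

/-- The argument of the logarithm does not change when `B *ᵥ s` is rescaled, so the unknown step
length in `B *ᵥ s = -(τ • g)` drops out of the bound. -/
theorem potential_dualUpdate_le {s y : ι → ℝ} (hB : B.PosDef) (hsy : 0 < s ⬝ᵥ y) :
    potential (dualUpdate s y B) ≤ potential B + (y ⬝ᵥ y) / (s ⬝ᵥ y) - 1 +
      Real.log ((s ⬝ᵥ B *ᵥ s) ^ 2 / ((B *ᵥ s ⬝ᵥ B *ᵥ s) * (s ⬝ᵥ y))) := by
  have hs : s ≠ 0 := by
    rintro rfl
    simp at hsy
  have hsB : 0 < s ⬝ᵥ B *ᵥ s := by simpa using hB.dotProduct_mulVec_pos hs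
  have hBs : B *ᵥ s ≠ 0 := fun h => by simp [h] at hsB
  have hBB : 0 < B *ᵥ s ⬝ᵥ B *ᵥ s := by simpa using dotProduct_star_self_pos_iff.2 hBs
  have hsymm : B.IsSymm := hB.isHermitian
  rw [potential, potential, trace_dualUpdate,
    det_dualUpdate hsymm hB.det_pos.ne' hsy.ne' hsB.ne',
    Real.log_mul hB.det_pos.ne' (div_pos hsy hsB).ne', Real.log_div hsy.ne' hsB.ne',
    Real.log_div (by positivity) (by positivity), Real.log_mul hBB.ne' hsy.ne', Real.log_pow]
  have hlog := Real.log_le_sub_one_of_pos (div_pos hBB hsB)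
  rw [Real.log_div hBB.ne' hsB.ne'] at hlog
  push_cast
  linarith

end Potential

section QuasiNewtonStep

section Field

variable {ι K : Type*} [Fintype ι] [DecidableEq ι] [Field K] {H : Matrix ι ι K} {g s : ι → K}
  {t : K}

theorem ne_zero_of_mulVec_eq_neg_smul (hH : IsUnit H.det) (hg : g ≠ 0)
    (hdir : H *ᵥ g = -(t • s)) : t ≠ 0 := by
  rintro rfl
  rw [zero_smul, neg_zero] at hdir
  exact hg (eq_zero_of_mulVec_eq_zero hH.ne_zero hdir)

theorem inv_mulVec_eq_neg_inv_smul (hH : IsUnit H.det) (hg : g ≠ 0)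
    (hdir : H *ᵥ g = -(t • s)) : H⁻¹ *ᵥ s = -(t⁻¹ • g) := by
  have hg' : g = -(t • H⁻¹ *ᵥ s) := by
    rw [← mulVec_smul, ← mulVec_neg, ← hdir, mulVec_mulVec, nonsing_inv_mul H hH, one_mulVec]
  rw [hg', smul_neg, neg_neg, inv_smul_smul₀ (ne_zero_of_mulVec_eq_neg_smul hH hg hdir)]

end Field

variable {n : ℕ} {H : Matrix (Fin n) (Fin n) ℝ} {g s y : EuclideanSpace ℝ (Fin n)} {t ν : ℝ}

theorem inner_eq_dotProduct (u v : EuclideanSpace ℝ (Fin n)) :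
    inner ℝ u v = u.ofLp ⬝ᵥ v.ofLp := by
  rw [EuclideanSpace.inner_eq_star_dotProduct, star_trivial, dotProduct_comm]

theorem inner_neg_of_mulVec_eq_neg_smul (hH : H.PosDef) (hg : g ≠ 0) (ht : 0 ≤ t)
    (hdir : H *ᵥ g.ofLp = -(t • s.ofLp)) : inner ℝ g s < 0 := by
  have hgHg := hH.dotProduct_mulVec_pos (x := g.ofLp) (by simpa using hg)
  rw [hdir, star_trivial, dotProduct_neg, dotProduct_smul, smul_eq_mul, ← inner_eq_dotProduct,
    ← mul_neg] at hgHg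
  exact neg_pos.1 (pos_of_mul_pos_right hgHg ht)

theorem inner_pos_of_wolfe (hν : ν < 1) (hgs : inner ℝ g s < 0)
    (hwolfe : (1 - ν) * -inner ℝ g s ≤ inner ℝ s y) : 0 < inner ℝ s y :=
  (mul_pos (sub_pos.2 hν) (neg_pos.2 hgs)).trans_le hwolfe

theorem potential_inv_update_le (hH : H.PosDef) (hg : g ≠ 0) (ht : 0 ≤ t)
    (hdir : H *ᵥ g.ofLp = -(t • s.ofLp)) (hν : ν < 1)
    (hwolfe : (1 - ν) * -inner ℝ g s ≤ inner ℝ s y) :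
    potential (update s y H)⁻¹ ≤ potential H⁻¹ + ‖y‖ ^ 2 / inner ℝ s y - 1 +
      Real.log (-inner ℝ g s / ((1 - ν) * ‖g‖ ^ 2)) := by
  have hgs : 0 < -inner ℝ g s := neg_pos.2 (inner_neg_of_mulVec_eq_neg_smul hH hg ht hdir)
  have hsy := inner_pos_of_wolfe hν (neg_pos.1 hgs) hwolfe
  have hsy' : 0 < s.ofLp ⬝ᵥ y.ofLp := inner_eq_dotProduct s y ▸ hsy
  have hdet := hH.det_pos.ne'.isUnit
  have hg' : g.ofLp ≠ 0 := by simpa using hg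
  have ht0 : 0 < t := ht.lt_of_ne' (ne_zero_of_mulVec_eq_neg_smul hdet hg' hdir)
  have hBs := inv_mulVec_eq_neg_inv_smul hdet hg' hdir
  have hsBs : s.ofLp ⬝ᵥ H⁻¹ *ᵥ s.ofLp = t⁻¹ * -inner ℝ g s := by
    rw [hBs, dotProduct_neg, dotProduct_smul, smul_eq_mul, ← inner_eq_dotProduct,
      real_inner_comm, mul_neg]
  have hBsBs : H⁻¹ *ᵥ s.ofLp ⬝ᵥ H⁻¹ *ᵥ s.ofLp = t⁻¹ ^ 2 * ‖g‖ ^ 2 := by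
    rw [hBs, neg_dotProduct_neg, smul_dotProduct, dotProduct_smul, ← inner_eq_dotProduct,
      real_inner_self_eq_norm_sq, smul_eq_mul, smul_eq_mul, sq t⁻¹, mul_assoc]
  have hbound := potential_dualUpdate_le hH.inv hsy'
  rw [← inv_update hH hsy', hsBs, hBsBs, ← inner_eq_dotProduct, ← inner_eq_dotProduct,
    real_inner_self_eq_norm_sq] at hbound
  have hden : 0 < (1 - ν) * ‖g‖ ^ 2 := mul_pos (sub_pos.2 hν) (by positivity)
  have hden' : 0 < t⁻¹ ^ 2 * ‖g‖ ^ 2 * inner ℝ s y := mul_pos (by positivity) hsy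
  refine hbound.trans (add_le_add_right
    (Real.log_le_log (div_pos (pow_pos (mul_pos (inv_pos.2 ht0) hgs) 2) hden') ?_) _)
  rw [div_le_div_iff₀ hden' hden]
  calc (t⁻¹ * -inner ℝ g s) ^ 2 * ((1 - ν) * ‖g‖ ^ 2)
      = t⁻¹ ^ 2 * -inner ℝ g s * ‖g‖ ^ 2 * ((1 - ν) * -inner ℝ g s) := by ring
    _ ≤ t⁻¹ ^ 2 * -inner ℝ g s * ‖g‖ ^ 2 * inner ℝ s y := by gcongr
    _ = -inner ℝ g s * (t⁻¹ ^ 2 * ‖g‖ ^ 2 * inner ℝ s y) := by ring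

end QuasiNewtonStep

section LineSearch

theorem tendsto_atBot_of_succ_le_add {Φ a : ℕ → ℝ} (hΦ : ∀ k, Φ (k + 1) ≤ Φ k + a k)
    (ha : Tendsto a atTop atBot) : Tendsto Φ atTop atBot := by
  obtain ⟨N, hN⟩ := eventually_atTop.1 (ha.eventually_le_atBot (-1))
  have hlinear : ∀ m : ℕ, Φ (m + N) ≤ Φ N - m := fun m => by
    induction m with
    | zero => simp
    | succ m ih =>
      rw [add_right_comm]
      push_cast
      linarith [hΦ (m + N), hN (m + N) (Nat.le_add_left N m)]
  exact (tendsto_add_atTop_iff_nat N).1 <| tendsto_atBot_mono hlinear <|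
    tendsto_atBot_add_const_left _ _ (tendsto_neg_atTop_atBot.comp tendsto_natCast_atTop_atTop)

variable {n : ℕ} {f : EuclideanSpace ℝ (Fin n) → ℝ} {x : ℕ → EuclideanSpace ℝ (Fin n)} {ν : ℝ}

theorem mul_neg_inner_step_le_of_wolfe {k : ℕ}
    (hwolfe : ν * inner ℝ (gradient f (x k)) (step x k) ≤
      inner ℝ (gradient f (x (k + 1))) (step x k)) :
    (1 - ν) * -inner ℝ (gradient f (x k)) (step x k) ≤ inner ℝ (step x k) (gradDiff f x k) := by
  rw [gradDiff, inner_sub_right, real_inner_comm _ (step x k), real_inner_comm _ (step x k)]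
  linarith

theorem posDef_invHessian {H₀ : Matrix (Fin n) (Fin n) ℝ} (hgrad : ∀ k, gradient f (x k) ≠ 0)
    (hν : ν < 1) (hH₀ : H₀.PosDef)
    (hdir : ∀ k, ∃ t : ℝ, 0 ≤ t ∧
      invHessian f x H₀ k *ᵥ (gradient f (x k)).ofLp = -(t • (step x k).ofLp))
    (hwolfe : ∀ k, ν * inner ℝ (gradient f (x k)) (step x k) ≤
      inner ℝ (gradient f (x (k + 1))) (step x k)) (k : ℕ) :
    (invHessian f x H₀ k).PosDef := by
  induction k with
  | zero => exact hH₀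
  | succ k ih =>
    obtain ⟨t, ht, htdir⟩ := hdir k
    have hsy := inner_pos_of_wolfe hν (inner_neg_of_mulVec_eq_neg_smul ih (hgrad k) ht htdir)
      (mul_neg_inner_step_le_of_wolfe (hwolfe k))
    rw [inner_eq_dotProduct] at hsy
    exact posDef_update ih hsy

namespace IsBFGSSequence

theorem inner_gradient_step_neg (hx : IsBFGSSequence f x) (k : ℕ) :
    inner ℝ (gradient f (x k)) (step x k) < 0 := by
  obtain ⟨hgrad, μ, ν, H₀, -, -, hν, hH₀, hstep⟩ := hx
  obtain ⟨t, ht, hdir⟩ := (hstep k).1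
  exact inner_neg_of_mulVec_eq_neg_smul (posDef_invHessian (fun k => (hgrad k).2) hν hH₀
    (fun k => (hstep k).1) (fun k => (hstep k).2.2) k) (hgrad k).2 ht hdir

theorem inner_step_gradDiff_pos (hx : IsBFGSSequence f x) (k : ℕ) :
    0 < inner ℝ (step x k) (gradDiff f x k) := by
  have hgs := hx.inner_gradient_step_neg k
  obtain ⟨-, μ, ν, H₀, -, -, hν, -, hstep⟩ := hx
  exact inner_pos_of_wolfe hν hgs (mul_neg_inner_step_le_of_wolfe (hstep k).2.2)

theorem antitone (hx : IsBFGSSequence f x) : Antitone fun k => f (x k) := by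
  refine antitone_nat_of_succ_le fun k => ?_
  have hgs := hx.inner_gradient_step_neg k
  obtain ⟨-, μ, ν, H₀, hμ, -, -, -, hstep⟩ := hx
  exact (hstep k).2.1.trans (add_le_of_nonpos_right (mul_nonpos_of_nonneg_of_nonpos hμ.le hgs.le))

theorem tendsto_inner_gradient_step (hx : IsBFGSSequence f x)
    (hf : BddBelow (Set.range fun k => f (x k))) :
    Tendsto (fun k => inner ℝ (gradient f (x k)) (step x k)) atTop (𝓝 0) := by
  have hlim := tendsto_atTop_ciInf hx.antitone hf
  have hgs := hx.inner_gradient_step_neg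
  obtain ⟨-, μ, ν, H₀, hμ, -, -, -, hstep⟩ := hx
  have hdecr : Tendsto (fun k => μ⁻¹ * (f (x (k + 1)) - f (x k))) atTop (𝓝 0) := by
    simpa using ((hlim.comp (tendsto_add_atTop_nat 1)).sub hlim).const_mul μ⁻¹
  refine tendsto_of_tendsto_of_tendsto_of_le_of_le hdecr tendsto_const_nhds (fun k => ?_)
    fun k => (hgs k).le
  rw [inv_mul_le_iff₀ hμ]
  linarith [(hstep k).2.1]

theorem exists_potential (hx : IsBFGSSequence f x) :
    ∃ (ν : ℝ) (Φ : ℕ → ℝ), ν < 1 ∧ (∀ k, 0 ≤ Φ k) ∧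
      ∀ k, Φ (k + 1) ≤ Φ k + (‖gradDiff f x k‖ ^ 2 / inner ℝ (step x k) (gradDiff f x k) - 1 +
        Real.log (-inner ℝ (gradient f (x k)) (step x k) /
          ((1 - ν) * ‖gradient f (x k)‖ ^ 2))) := by
  obtain ⟨hgrad, μ, ν, H₀, -, -, hν, hH₀, hstep⟩ := hx
  have hpd := posDef_invHessian (fun k => (hgrad k).2) hν hH₀ (fun k => (hstep k).1)
    fun k => (hstep k).2.2
  refine ⟨ν, fun k => potential (invHessian f x H₀ k)⁻¹, hν,
    fun k => (Nat.cast_nonneg _).trans (card_le_potential (hpd k).inv), fun k => ?_⟩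
  obtain ⟨t, ht, hdir⟩ := (hstep k).1
  exact (potential_inv_update_le (hpd k) (hgrad k).2 ht hdir hν
    (mul_neg_inner_step_le_of_wolfe (hstep k).2.2)).trans_eq (by ring)

theorem exists_norm_gradient_lt {c ε : ℝ} (hx : IsBFGSSequence f x)
    (hf : BddBelow (Set.range fun k => f (x k))) (hc : 0 < c)
    (hcoercive : ∀ k, c * ‖gradDiff f x k‖ ^ 2 ≤ inner ℝ (step x k) (gradDiff f x k))
    (hε : 0 < ε) : ∃ k, ‖gradient f (x k)‖ < ε := by
  by_contra! hgrad
  obtain ⟨ν, Φ, hν, hΦ, hsucc⟩ := hx.exists_potential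
  have hν' : 0 < (1 - ν) * ε ^ 2 := mul_pos (sub_pos.2 hν) (pow_pos hε 2)
  set δ : ℕ → ℝ := fun k => -inner ℝ (gradient f (x k)) (step x k) / ((1 - ν) * ε ^ 2)
  have hδpos : ∀ k, 0 < δ k := fun k => div_pos (neg_pos.2 (hx.inner_gradient_step_neg k)) hν'
  have hδ : Tendsto δ atTop (𝓝[>] 0) :=
    tendsto_nhdsWithin_iff.2 ⟨by simpa only [neg_zero, zero_div] using
      (hx.tendsto_inner_gradient_step hf).neg.div_const ((1 - ν) * ε ^ 2), .of_forall hδpos⟩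
  have hratio : ∀ k, ‖gradDiff f x k‖ ^ 2 / inner ℝ (step x k) (gradDiff f x k) ≤ c⁻¹ := fun k => by
    rw [div_le_iff₀ (hx.inner_step_gradDiff_pos k), le_inv_mul_iff₀ hc]
    exact hcoercive k
  have hlog : ∀ k, Real.log (-inner ℝ (gradient f (x k)) (step x k) /
      ((1 - ν) * ‖gradient f (x k)‖ ^ 2)) ≤ Real.log (δ k) := fun k => by
    have hgs : 0 < -inner ℝ (gradient f (x k)) (step x k) :=
      neg_pos.2 (hx.inner_gradient_step_neg k)
    have hdenom : (1 - ν) * ε ^ 2 ≤ (1 - ν) * ‖gradient f (x k)‖ ^ 2 :=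
      mul_le_mul_of_nonneg_left (pow_le_pow_left₀ hε.le (hgrad k) 2) (sub_pos.2 hν).le
    exact Real.log_le_log (div_pos hgs (hν'.trans_le hdenom))
      (div_le_div_of_nonneg_left hgs.le hν' hdenom)
  have hΦlim : Tendsto Φ atTop atBot := by
    refine tendsto_atBot_of_succ_le_add (a := fun k => c⁻¹ - 1 + Real.log (δ k))
      (fun k => (hsucc k).trans ?_)
      (tendsto_atBot_add_const_left _ _ (Real.tendsto_log_nhdsGT_zero.comp hδ))
    linarith [hratio k, hlog k]
  exact not_bddBelow_of_tendsto_atBot hΦlim ⟨0, Set.forall_mem_range.2 hΦ⟩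

end IsBFGSSequence

end LineSearch

section Norm

open NormedSpace (normalize norm_smul_normalize norm_normalize_eq_one_iff)

variable {E : Type*} [NormedAddCommGroup E] [InnerProductSpace ℝ E]

theorem gradient_norm_of_ne_zero [CompleteSpace E] {x : E} (hx : x ≠ 0) :
    gradient (fun z : E => ‖z‖) x = normalize x := by
  have hsqrt := (hasStrictFDerivAt_norm_sq x).hasFDerivAt.sqrt (by positivity)
  simp only [Real.sqrt_sq (norm_nonneg _)] at hsqrt
  refine HasGradientAt.gradient (hasGradientAt_iff_hasFDerivAt.2 (hsqrt.congr_fderiv ?_))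
  ext v
  simp only [one_div, _root_.mul_inv_rev, _root_.smul_apply, coe_innerSL_apply, nsmul_eq_mul,
    Nat.cast_ofNat, smul_eq_mul, NormedSpace.normalize, map_smul,
    InnerProductSpace.toDual_apply_apply]
  field_simp

theorem ne_zero_of_gradient_norm_ne_zero [CompleteSpace E] {x : E}
    (h : gradient (fun z : E => ‖z‖) x ≠ 0) : x ≠ 0 := by
  rintro rfl
  have : Nontrivial E := ⟨_, _, h⟩
  exact h (gradient_eq_zero_of_not_differentiableAt (not_differentiableAt_norm_zero E))

theorem two_mul_inner_sub_normalize_sub {x z : E} (hx : x ≠ 0) (hz : z ≠ 0) :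
    2 * inner ℝ (z - x) (normalize z - normalize x) =
      (‖x‖ + ‖z‖) * ‖normalize z - normalize x‖ ^ 2 := by
  have hxx : inner ℝ (normalize x) (normalize x) = 1 := by
    rw [real_inner_self_eq_norm_sq, norm_normalize_eq_one_iff.2 hx, one_pow]
  have hzz : inner ℝ (normalize z) (normalize z) = 1 := by
    rw [real_inner_self_eq_norm_sq, norm_normalize_eq_one_iff.2 hz, one_pow]
  rw [← real_inner_self_eq_norm_sq]
  nth_rw 1 [← norm_smul_normalize x, ← norm_smul_normalize z]
  simp only [inner_sub_left, inner_sub_right, real_inner_smul_left, hxx, hzz,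
    real_inner_comm (normalize x) (normalize z)]
  ring

theorem mul_norm_normalize_sub_sq_le_inner {x z : E} {r : ℝ} (hr : 0 < r) (hx : r ≤ ‖x‖)
    (hz : r ≤ ‖z‖) :
    r * ‖normalize z - normalize x‖ ^ 2 ≤ inner ℝ (z - x) (normalize z - normalize x) := by
  have hidentity := two_mul_inner_sub_normalize_sub (norm_pos_iff.1 (hr.trans_le hx))
    (norm_pos_iff.1 (hr.trans_le hz))
  nlinarith [sq_nonneg ‖normalize z - normalize x‖]

end Norm

end BFGS

theorem mainTheorem2 (n : ℕ) (x : ℕ → EuclideanSpace ℝ (Fin n))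
    (hx : BFGS.IsBFGSSequence (fun z : EuclideanSpace ℝ (Fin n) => ‖z‖) x) :
    Filter.Tendsto x Filter.atTop (nhds 0) := by
  have hx0 : ∀ k, x k ≠ 0 := fun k => BFGS.ne_zero_of_gradient_norm_ne_zero (hx.1 k).2
  have hgrad : ∀ k, gradient (fun z : EuclideanSpace ℝ (Fin n) => ‖z‖) (x k) =
      NormedSpace.normalize (x k) := fun k => BFGS.gradient_norm_of_ne_zero (hx0 k)
  have hbdd : BddBelow (Set.range fun k => ‖x k‖) :=
    ⟨0, Set.forall_mem_range.2 fun k => norm_nonneg (x k)⟩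
  have hlim := tendsto_atTop_ciInf hx.antitone hbdd
  set r := ⨅ k, ‖x k‖
  suffices hr : r = 0 by rwa [tendsto_zero_iff_norm_tendsto_zero, ← hr]
  by_contra hr
  have hr0 : 0 < r := (Real.iInf_nonneg fun k => norm_nonneg (x k)).lt_of_ne' hr
  have hrx : ∀ k, r ≤ ‖x k‖ := ciInf_le hbdd
  have hcoercive : ∀ k, r * ‖BFGS.gradDiff (fun z => ‖z‖) x k‖ ^ 2 ≤
      inner ℝ (BFGS.step x k) (BFGS.gradDiff (fun z => ‖z‖) x k) := fun k => by
    rw [BFGS.gradDiff, hgrad, hgrad]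
    exact BFGS.mul_norm_normalize_sub_sq_le_inner hr0 (hrx k) (hrx (k + 1))
  obtain ⟨k, hk⟩ := hx.exists_norm_gradient_lt hbdd hr0 hcoercive one_pos
  rw [hgrad, NormedSpace.norm_normalize_eq_one_iff.2 (hx0 k)] at hk
  exact hk.false
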